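/- **Setting.** Let $\mathcal N$ be a finite nonempty set of agents. Each agent $i$ has a finite set $A_i$ of actions; put $A=\prod_i A_i$, let $\Delta(A_i)$ be the set of probability vectors on $A_i$, and let $\Psi(b)\in\Delta(A_i)$ be the unit vector of $b\in A_i$. Let $\Theta$ be a measurable space, $\Delta(\Theta)$ the set of probability measures on it, and $u:A\times\Theta\to\mathbb R$ an objective such that $u(a,\cdot)$ is measurable and bounded for each $a\in A$. For $\sigma\in\prod_i\Delta(A_i)$ and $\nu\in\Delta(\Theta)$ write $$u(\sigma;\nu)=\int_\Theta\sum_{a\in A}u(a,\theta)\prod_{i}\sigma_i(a_i)\,d\nu(\theta).$$ **Assumptions.** Let $\mathcal E(t)$, $t=0,1,\dots$, be the symmetric edge sets of graphs on $\mathcal N$, let $\mathcal N(i,t)$ be the set of neighbours of $i$ in $\mathcal E(t)$, and let $\mathcal E(\infty)$ be the set of pairs that lie in $\mathcal E(t)$ for infinitely many $t$. 1. (Connectivity) The graph $(\mathcal N,\mathcal E(\infty))$ is connected. 2. (Bounded intercommunication) There is an integer $T\ge 1$ such that $(i,j)\in\mathcal E(k)\cup\dots\cup\mathcal E(k+T-1)$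 for all $(i,j)\in\mathcal E(\infty)$ and $k\ge 0$. 3. (Weights) The weights $w^i_{j,k}(t)\ge 0$ satisfy, for some $\eta\in(0,1)$ and all $t,i,j,k$: $w^i_{j,k}(t)=0$ if $k\notin\mathcal N(i,t)\cup\{i\}$; $w^i_{j,k}(t)\ge\eta$ if $j\neq i$ and $k\in\mathcal N(i,t)\cup\{i\}$; $w^i_{i,i}(t)=1$; and $\sum_{k}w^i_{j,k}(t)=1$. 4. (State beliefs) The beliefs $\mu_i(t)\in\Delta(\Theta)$ satisfy $\lim_{t\to\infty}\sup_B|\mu_i(t)(B)-\mu(B)|=0$ for all $i$, where $\mu\in\Delta(\Theta)$ is common to all agents and $B$ ranges over the measurable subsets of $\Theta$. **Algorithm (decentralized fictitious play).** Choose an initial action profile $a(0)\in A$ arbitrarily and put $v^i_j(1)=f_j(1)=\Psi(a_j(0))$ for all $i,j$. For $t=1,2,\dots$, $$a_i(t)\in\operatorname*{argmax}_{b\in A_i}u\big((\Psi(b),v^i_{-i}(t));\mu_i(t)\big),\qquad f_i(t+1)=f_i(t)+\tfrac1t\big(\Psi(a_i(t))-f_i(t)\big),$$ $$v^i_i(t)=f_i(t),\qquad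 v^i_j(t+1)=\sum_{k\in\mathcal N}w^i_{j,k}(t)\,v^k_j(t)\quad(j\ne i).$$ The first actions $a_i(1)$ may also be chosen arbitrarily, and instead of $v^j_j(t)=f_j(t)$ agent $j$ may transmit its updated frequency $f_j(t+1)$ (that is, in the last formula the term $k=j$ may be replaced, for all $i,j,t$, by $w^i_{j,j}(t)f_j(t+1)$). **Theorem.** Under assumptions 1–4, let $f_t=(f_i(t))_{i\in\mathcal N}$ be the empirical frequencies of any run of this algorithm, and let $K(\mu)$ be the set of (mixed) Nash equilibria of the game $\Gamma(\mu)$ in which every agent has the payoff $u(\cdot\,;\mu)$, i.e. of all $\sigma^*\in\prod_i\Delta(A_i)$ such that $u(\sigma^*;\mu)\ge u((\sigma_i,\sigma^*_{-i});\mu)$ for all $i$ and all $\sigma_i\in\Delta(A_i)$. Then the minimum below (in the Euclidean norm) is attained for every $t\ge1$, and $$\lim_{t\to\infty}\min_{\sigma^*\in K(\mu)}\|f_t-\sigma^*\|=0 .$$ -/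

import Mathlib

open Filter Topology MeasureTheory

noncomputable section

namespace DFP

/-- The graph `(N, E(∞))`: `i` and `j` are linked when they communicate infinitely often. -/
def limitGraph {ι : Type*} (G : ℕ → SimpleGraph ι) : SimpleGraph ι where
  Adj i j := ∃ᶠ t in atTop, (G t).Adj i j
  symm := ⟨fun _ _ h => h.mono fun t ht => (G t).adj_symm ht⟩
  loopless := ⟨fun i h => by
    obtain ⟨t, ht⟩ := h.exists
    exact (G t).loopless.irrefl i ht⟩

/-- Bounded intercommunication interval: for some `T ≥ 1`, every edge of `E(∞)` occurs in each
window `E(k) ∪ ⋯ ∪ E(k + T - 1)`. -/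
def BoundedIntercommunication {ι : Type*} (G : ℕ → SimpleGraph ι) : Prop :=
  ∃ T : ℕ, 1 ≤ T ∧ ∀ i j, (limitGraph G).Adj i j → ∀ k, ∃ τ < T, (G (k + τ)).Adj i j

/-- Assumption on the weights. `w t i j k` is the weight `w^i_{j,k}(t)` which agent `i` puts at
time `t` on agent `k`'s estimate of agent `j`. An agent is stubborn about its own frequency, so
the lower bound on the weights of neighbours concerns the estimates of other agents `j ≠ i` (for
`j = i` the last two fields and nonnegativity leave the unit row only). -/
structure WeightAssumption {ι : Type*} [Fintype ι]
    (G : ℕ → SimpleGraph ι) (w : ℕ → ι → ι → ι → ℝ) (η : ℝ) : Prop where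
  eta_pos : 0 < η
  eta_lt_one : η < 1
  nonneg : ∀ t i j k, 0 ≤ w t i j k
  lower : ∀ t i j k, j ≠ i → (k = i ∨ (G t).Adj i k) → η ≤ w t i j k
  zero : ∀ t i j k, ¬ (k = i ∨ (G t).Adj i k) → w t i j k = 0
  stubborn : ∀ t i, w t i i i = 1
  sum_one : ∀ t i j, ∑ k, w t i j k = 1

/-- Total variation distance, `sup_B |μ(B) - ν(B)|` over the measurable sets `B`. -/
def tv {Θ : Type*} [MeasurableSpace Θ] (μ ν : ProbabilityMeasure Θ) : ℝ :=
  ⨆ B : {B : Set Θ // MeasurableSet B}, |(μ : Measure Θ).real B - (ν : Measure Θ).real B|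

/-- The unit vector `Ψ(b)` of an action `b`. -/
def Psi {α : Type*} [DecidableEq α] (b : α) : α → ℝ := fun c => if c = b then 1 else 0

section Game

variable {ι : Type*} [Fintype ι] [DecidableEq ι] {A : ι → Type*} [∀ i, Fintype (A i)]
  {Θ : Type*} [MeasurableSpace Θ]

/-- `u(σ, θ) = ∑_a u(a, θ) σ(a)`, where `σ(a) = ∏_i σ_i(a_i)`. -/
def mixedPayoff (u : (∀ i, A i) → Θ → ℝ) (σ : ∀ i, A i → ℝ) (θ : Θ) : ℝ :=
  ∑ a : (∀ i, A i), u a θ * ∏ i, σ i (a i)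

/-- `u(σ; ν)`, the expectation of `u(σ, θ)` when `θ` has distribution `ν`. -/
def expPayoff (u : (∀ i, A i) → Θ → ℝ) (ν : ProbabilityMeasure Θ) (σ : ∀ i, A i → ℝ) : ℝ :=
  ∫ θ, mixedPayoff u σ θ ∂(ν : Measure Θ)

/-- The set `K(ν)` of (mixed) Nash equilibria of the game `Γ(ν)` in which every agent has the
payoff `u(·; ν)`. -/
def nashSet (u : (∀ i, A i) → Θ → ℝ) (ν : ProbabilityMeasure Θ) : Set (∀ i, A i → ℝ) :=
  {σ | (∀ i, σ i ∈ stdSimplex ℝ (A i)) ∧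
    ∀ i, ∀ s ∈ stdSimplex ℝ (A i), expPayoff u ν (Function.update σ i s) ≤ expPayoff u ν σ}

/-- The Euclidean distance of two profiles. -/
def profileDist (σ τ : ∀ i, A i → ℝ) : ℝ :=
  √(∑ i, ∑ b, (σ i b - τ i b) ^ 2)

/-- A run of decentralized fictitious play: actions `a t i`, empirical frequencies `f t i` and
estimates `v t i j` (agent `i`'s estimate of `f t j`), given the weights `w` and the state beliefs
`μ t i`. The run starts at time `1`; `a 0` is the arbitrary initial profile.

With `d = 0` agent `j` transmits `f t j` about itself in the exchange after decision epoch `t`;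
with `d = 1` it transmits its just updated frequency `f (t + 1) j`. The first decision `a 1` is left
free: it may be a best response to the initial estimates, or be the initial profile itself. -/
structure IsRun [∀ i, DecidableEq (A i)] (u : (∀ i, A i) → Θ → ℝ)
    (w : ℕ → ι → ι → ι → ℝ) (μ : ℕ → ι → ProbabilityMeasure Θ) (d : ℕ)
    (a : ℕ → ∀ i, A i) (f : ℕ → ∀ i, A i → ℝ) (v : ℕ → ι → ∀ j, A j → ℝ) : Prop where
  init_freq : ∀ j, f 1 j = Psi (a 0 j)
  init_estimate : ∀ i j, v 1 i j = f 1 j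
  best_response : ∀ t, 2 ≤ t → ∀ i, ∀ b : A i,
    expPayoff u (μ t i) (Function.update (v t i) i (Psi b)) ≤
      expPayoff u (μ t i) (Function.update (v t i) i (Psi (a t i)))
  freq_update : ∀ t, 1 ≤ t → ∀ i,
    f (t + 1) i = f t i + (1 / (t : ℝ)) • (Psi (a t i) - f t i)
  own_estimate : ∀ t, 1 ≤ t → ∀ i, v t i i = f t i
  estimate_update : ∀ t, 1 ≤ t → ∀ i j, j ≠ i →
    v (t + 1) i j = ∑ k, w t i j k • (if k = j then f (t + d) j else v t k j)

end Game

end DFP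

end

/-! Let c(a) be the mean of u(a,·) under the limit belief. The multilinear common payoff `potential
c` acts as a Lyapunov function. Frequencies move by at most 1/t per step while averaging contracts
estimation errors, so all estimates track them (`IsRun.tendsto_estimate_sub_freq`). With total
variation convergence of beliefs, actions become best responses to f_t up to o(1). A first-order
expansion then bounds the increments of the potential below by (gap - o(1))/t, where `gap` is the
total gain from unilateral deviations.

The errors o(1)/t need not be summable, so monotonicity alone does not make the potential converge.
Instead, the potential takes finitely many values on equilibria (`finite_image_equilibria`). Near
any other value the gap is bounded below, so the potential eventually increases there and cannot
oscillate across that level: it converges. A gap that stays large near time t would persist for a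
time proportional to t and raise the potential by a fixed amount, so the gap tends to 0, and
compactness gives convergence to equilibria.

The finiteness is an algebraic Sard argument. With infinitely many values, the potential would be
transcendental over ℝ in some residue field of the function algebra, hence have nonzero Kähler
differential; but the indifference conditions x(q - p) = 0 force dp = 0. -/

/-! ### Kähler differentials and finiteness of critical values -/

open scoped IntermediateField.algebraAdjoinAdjoin in
/-- In characteristic zero the universal derivation does not kill transcendental elements. -/
theorem KaehlerDifferential.D_ne_zero_of_transcendental {k L : Type*} [Field k] [CharZero k]
    [Field L] [Algebra k L] {x : L} (hx : Transcendental k x) :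
    KaehlerDifferential.D k L x ≠ 0 := by
  classical
  -- Extend x to a transcendence basis. In characteristic zero L is formally étale over the
  -- polynomial ring on it, so the differentials of the variables form an L-basis of Ω, and dx is
  -- one of them.
  obtain ⟨t, hxt, ht⟩ := exists_isTranscendenceBasis_superset (R := k) (s := {x})
    (algebraicIndependent_unique_type_iff.mpr hx)
  let S := Algebra.adjoin k (Set.range ((↑) : t → L))
  let E := IntermediateField.adjoin k (Set.range ((↑) : t → L))
  have : Algebra.IsAlgebraic E L := ht.isAlgebraic_field
  have : Algebra.FormallyEtale E L := Algebra.FormallyEtale.of_isSeparable _ L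
  have : Algebra.FormallyEtale S E := .of_isLocalization (nonZeroDivisors _)
  have : Algebra.FormallyEtale S L := .comp S E L
  let e : MvPolynomial t k ≃ₐ[k] S := ht.1.aevalEquiv
  let : Algebra (MvPolynomial t k) S := e.toRingHom.toAlgebra
  let : Algebra (MvPolynomial t k) L := ((algebraMap S L).comp e.toRingHom).toAlgebra
  have : IsScalarTower (MvPolynomial t k) S L := .of_algebraMap_eq fun _ => rfl
  have : IsScalarTower k (MvPolynomial t k) L := .of_algebraMap_eq fun c => by
    change _ = algebraMap S L (e (algebraMap k (MvPolynomial t k) c))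
    rw [e.commutes, ← IsScalarTower.algebraMap_apply]
  have : Algebra.FormallyEtale (MvPolynomial t k) S :=
    .of_equiv (AlgEquiv.ofRingEquiv (f := e.toRingEquiv) fun _ => rfl : MvPolynomial t k ≃ₐ[MvPolynomial t k] S)
  have : Algebra.FormallyEtale (MvPolynomial t k) L := .comp (MvPolynomial t k) S L
  let b := (KaehlerDifferential.mvPolynomialBasis k t).baseChange L
  have hX : algebraMap (MvPolynomial t k) L (MvPolynomial.X ⟨x, hxt rfl⟩) = x := by
    change ((ht.1.aevalEquiv (MvPolynomial.X _) : S) : L) = x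
    simp
  intro h0
  have h1 := KaehlerDifferential.tensorKaehlerEquivOfFormallyEtale_symm_D_algebraMap k (MvPolynomial t k) L
    (MvPolynomial.X ⟨x, hxt rfl⟩)
  rw [hX, h0, map_zero] at h1
  have h2 := congrArg (fun z => b.repr z ⟨x, hxt rfl⟩) h1
  simp [b] at h2

/-- A real function takes only finitely many values if, at every point of the function algebra
over a field extension of `ℝ`, its differential vanishes. -/
theorem finite_range_of_forall_differential_eq_zero {X : Type*} (p : X → ℝ)
    (h : ∀ (M : Ideal (X → ℝ)) [M.IsMaximal],
      letI := Ideal.Quotient.field M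
      KaehlerDifferential.D ℝ ((X → ℝ) ⧸ M) (Ideal.Quotient.mk M p) = 0) :
    (Set.range p).Finite := by
  classical
  by_contra hinf
  -- Functions supported over finitely many values of p; proper exactly because p has infinite
  -- range.
  let J : Ideal (X → ℝ) :=
    { carrier := {f | (p '' {x | f x ≠ 0}).Finite}
      zero_mem' := by simp
      add_mem' := fun {f g} hf hg => (hf.union hg).subset <| by
        rw [← Set.image_union]
        refine Set.image_mono fun x hx => ?_
        by_contra hc
        simp only [Set.mem_union, Set.mem_ofPred_eq, not_or, not_not] at hc
        exact hx (by simp [hc.1, hc.2])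
      smul_mem' := fun c f hf => hf.subset <| Set.image_mono fun x hx h0 => hx (by simp [h0]) }
  have hJ : J ≠ ⊤ := by
    rw [Ne, Ideal.eq_top_iff_one]
    intro h1
    apply hinf
    have h2 : (p '' {x | (1 : X → ℝ) x ≠ 0}).Finite := h1
    simpa using h2
  obtain ⟨M, hM, hJM⟩ := Ideal.exists_le_maximal J hJ
  let := Ideal.Quotient.field M
  have halg : IsAlgebraic ℝ (Ideal.Quotient.mk M p) := by
    by_contra ht
    exact KaehlerDifferential.D_ne_zero_of_transcendental ht (h M)
  obtain ⟨q, hq, hq0⟩ := halg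
  have hqM : (fun x => q.eval (p x)) ∈ M := by
    have h1 : Polynomial.aeval (Ideal.Quotient.mkₐ ℝ M p) q = 0 := hq0
    rw [Polynomial.aeval_algHom_apply, Ideal.Quotient.mkₐ_eq_mk, Ideal.Quotient.eq_zero_iff_mem]
      at h1
    convert h1 using 1
    ext x
    simp
  -- A relation q(p) ∈ M is contradictory: q has finitely many roots, so the indicator of {q(p) = 0}
  -- lies in J ⊆ M, and adding it to q(p) gives a nowhere vanishing function, a unit.
  let g : X → ℝ := fun x => if q.eval (p x) = 0 then 1 else 0
  have hgM : g ∈ M := hJM <| show (p '' {x | g x ≠ 0}).Finite from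
    (Polynomial.finite_setOfPred_isRoot hq).subset <| by
      rintro _ ⟨x, hx, rfl⟩
      by_contra hc
      exact hx (if_neg hc)
  refine hM.ne_top (Ideal.eq_top_of_isUnit_mem M (M.add_mem hqM hgM) ?_)
  rw [Pi.isUnit_iff]
  intro x
  by_cases hx : q.eval (p x) = 0 <;> simp [g, hx]

/-- The Leibniz rule for a product over a finite type. -/
theorem Derivation.leibniz_prod_univ {R A M ι : Type*} [CommSemiring R] [CommSemiring A]
    [AddCommMonoid M] [Algebra R A] [Module A M] [Module R M] [DecidableEq ι] [Fintype ι]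
    (D : Derivation R A M) (g : ι → A) :
    D (∏ i, g i) = ∑ i, (∏ j ∈ Finset.univ.erase i, g j) • D (g i) := by
  suffices ∀ s : Finset ι, D (∏ i ∈ s, g i) = ∑ i ∈ s, (∏ j ∈ s.erase i, g j) • D (g i) from
    this Finset.univ
  intro s
  induction s using Finset.induction_on with
  | empty => simp
  | insert i s hi ih =>
    rw [Finset.prod_insert hi, D.leibniz, ih, Finset.sum_insert hi, Finset.erase_insert hi,
      Finset.smul_sum, add_comm]
    congr 1
    refine Finset.sum_congr rfl fun j hj => ?_
    have hij : i ≠ j := fun h => hi (h ▸ hj)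
    rw [Finset.erase_insert_of_ne hij, Finset.prod_insert (by simp [hi]), smul_smul]

namespace DFP

variable {ι : Type*} [Fintype ι] [DecidableEq ι] {A : ι → Type*} [∀ i, Fintype (A i)]

/-- The multilinear extension `∑_a c(a) σ(a)` of a payoff function `c` of pure profiles. -/
noncomputable def potential (c : (∀ i, A i) → ℝ) :
    ContinuousMultilinearMap ℝ (fun i => A i → ℝ) ℝ :=
  ∑ a, c a • (ContinuousMultilinearMap.mkPiAlgebra ℝ ι ℝ).compContinuousLinearMap
    (fun i => ContinuousLinearMap.proj (a i))

theorem potential_apply (c : (∀ i, A i) → ℝ) (σ : ∀ i, A i → ℝ) :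
    potential c σ = ∑ a, c a * ∏ i, σ i (a i) := by
  simp [potential]

variable [∀ i, DecidableEq (A i)]

theorem potential_update_Psi (c : (∀ i, A i) → ℝ) (σ : ∀ i, A i → ℝ) (i : ι) (b : A i) :
    potential c (Function.update σ i (Psi b)) =
      ∑ a, if a i = b then c a * ∏ j ∈ Finset.univ.erase i, σ j (a j) else 0 := by
  rw [potential_apply]
  refine Finset.sum_congr rfl fun a _ => ?_
  rw [← Finset.mul_prod_erase _ _ (Finset.mem_univ i)]
  have : ∏ j ∈ Finset.univ.erase i, Function.update σ i (Psi b) j (a j) =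
      ∏ j ∈ Finset.univ.erase i, σ j (a j) :=
    Finset.prod_congr rfl fun j hj => by
      rw [Function.update_of_ne (Finset.ne_of_mem_erase hj)]
  rw [this, Function.update_self]
  by_cases h : a i = b <;> simp [Psi, h]

/-- The potential takes finitely many values on profiles at which all actions in the support of
a player earn the same payoff. -/
theorem finite_image_potential (c : (∀ i, A i) → ℝ) (K : Set (∀ i, A i → ℝ))
    (hsum : ∀ σ ∈ K, ∀ i, ∑ b, σ i b = 1)
    (hcrit : ∀ σ ∈ K, ∀ i b, σ i b ≠ 0 →
      potential c (Function.update σ i (Psi b)) = potential c σ) :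
    (potential c '' K).Finite := by
  rw [← Set.range_domRestrict]
  refine finite_range_of_forall_differential_eq_zero _ fun M _ => ?_
  let := Ideal.Quotient.field M
  let φ := Ideal.Quotient.mkₐ ℝ M
  let D := KaehlerDifferential.D ℝ ((K → ℝ) ⧸ M)
  let x : ∀ i, A i → K → ℝ := fun i b σ => σ.1 i b
  let p : K → ℝ := K.domRestrict (potential c)
  let q : ∀ i, A i → K → ℝ := fun i b σ => potential c (Function.update σ.1 i (Psi b))
  have hp : p = ∑ a, c a • ∏ i, x i (a i) := by
    ext σ
    simp [p, x, potential_apply]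
  have hq : ∀ i b, q i b =
      ∑ a, if a i = b then c a • ∏ j ∈ Finset.univ.erase i, x j (a j) else 0 := by
    intro i b
    ext σ
    simp only [q, x, potential_update_Psi, Finset.sum_apply]
    refine Finset.sum_congr rfl fun a _ => ?_
    split_ifs <;> simp
  change D (φ p) = 0
  have h1 : D (φ p) = ∑ i, ∑ b, φ (q i b) • D (φ (x i b)) := by
    have : ∀ i, ∑ b, φ (q i b) • D (φ (x i b)) =
        ∑ a : (∀ i, A i), c a • (∏ j ∈ Finset.univ.erase i, φ (x j (a j))) • D (φ (x i (a i))) := by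
      intro i
      simp only [hq, map_sum, Finset.sum_smul]
      rw [Finset.sum_comm]
      refine Finset.sum_congr rfl fun a _ => ?_
      rw [Finset.sum_eq_single (a i)]
      · simp [map_smul, map_prod]
      · intro b _ hb
        simp [Ne.symm hb]
      · simp
    simp only [this]
    rw [Finset.sum_comm, hp, map_sum, map_sum]
    refine Finset.sum_congr rfl fun a _ => ?_
    rw [map_smul, map_prod, D.map_smul, Derivation.leibniz_prod_univ, Finset.smul_sum]
  -- In the residue field the relation x(q - p) = 0 splits: either x = 0, so dx = 0, or q = p. Hence
  -- dp = p · ∑ dx, and the probabilities of each player sum to the constant 1.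
  have h2 : ∀ i b, φ (q i b) • D (φ (x i b)) = φ p • D (φ (x i b)) := by
    intro i b
    have hz : x i b * (q i b - p) = 0 := by
      ext σ
      by_cases h : σ.1 i b = 0
      · simp [x, h]
      · simp [q, p, hcrit σ.1 σ.2 i b h]
    have hz' := congrArg φ hz
    rw [map_mul, map_sub, map_zero, mul_eq_zero] at hz'
    rcases hz' with h | h
    · simp [h]
    · rw [sub_eq_zero.mp h]
  have h3 : ∀ i, ∑ b, D (φ (x i b)) = 0 := by
    intro i
    have : ∑ b, x i b = 1 := by
      ext σ
      simp [x, hsum σ.1 σ.2 i]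
    rw [← map_sum, ← map_sum, this, map_one, Derivation.map_one_eq_zero]
  rw [h1]
  simp only [h2, ← Finset.smul_sum, h3, smul_zero, Finset.sum_const_zero]

end DFP

/-! ### Convergence of scalar sequences and compactness -/

/-- A bounded real sequence with vanishing increments converges if it is eventually nondecreasing
near every point outside a finite set. -/
theorem exists_tendsto_of_eventually_le_succ {φ : ℕ → ℝ} {B : ℝ} {V : Set ℝ}
    (hB : ∀ᶠ t in atTop, |φ t| ≤ B) (hV : V.Finite)
    (hstep : Tendsto (fun t => φ (t + 1) - φ t) atTop (𝓝 0))
    (hinc : ∀ x ∉ V, ∃ r > 0, ∀ᶠ t in atTop, |φ t - x| ≤ r → φ t ≤ φ (t + 1)) :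
    ∃ l, Tendsto φ atTop (𝓝 l) := by
  refine tendsto_of_no_upcrossings (s := Vᶜ) (hV.countable.dense_compl ℝ) ?_
    (isBoundedUnder_of_eventually_le (hB.mono fun t ht => (abs_le.mp ht).2))
    (isBoundedUnder_of_eventually_ge (hB.mono fun t ht => (abs_le.mp ht).1))
  rintro a - b hb hab ⟨ha', hb'⟩
  obtain ⟨r, hr, hrt⟩ := hinc b hb
  have h1 : ∀ᶠ t in atTop, |φ (t + 1) - φ t| < r := by
    have := (tendsto_order.1 (tendsto_zero_iff_abs_tendsto_zero _ |>.1 hstep)).2 r hr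
    simpa using this
  obtain ⟨N, hN⟩ := eventually_atTop.1 (hrt.and h1)
  obtain ⟨n, hn, hbn⟩ := (frequently_atTop.1 hb') N
  -- Once above b the sequence stays there: it cannot decrease within [b, b + r], and from above b +
  -- r a step shorter than r cannot reach below b.
  have key : ∀ m ≥ n, b ≤ φ m := by
    intro m hm
    induction m, hm using Nat.le_induction with
    | base => exact hbn.le
    | succ m hm ih =>
      obtain ⟨h2, h3⟩ := hN m (hn.trans hm)
      by_cases h4 : φ m ≤ b + r
      · exact ih.trans (h2 (abs_le.2 ⟨by linarith, by linarith⟩))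
      · linarith [(abs_lt.1 h3).1]
  obtain ⟨m, hm, ham⟩ := (frequently_atTop.1 ha') n
  linarith [key m hm]

/-- If a convergent sequence `φ` increases at rate at least `(g - o(1)) / t`, where `g ≥ 0` is a
uniformly continuous function of a sequence moving with speed `O(1 / t)`, then `g → 0`. -/
theorem tendsto_zero_of_increment_ge {X : Type*} [PseudoMetricSpace X] {f : ℕ → X}
    {φ g ε : ℕ → ℝ} {l C : ℝ} (hφ : Tendsto φ atTop (𝓝 l)) (hg : ∀ t, 1 ≤ t → 0 ≤ g t)
    (hε : Tendsto ε atTop (𝓝 0))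
    (hf : ∀ t, 1 ≤ t → dist (f t) (f (t + 1)) ≤ C / t)
    (hunif : ∀ γ > 0, ∃ δ > 0, ∀ s t, 1 ≤ s → 1 ≤ t → dist (f s) (f t) < δ → |g s - g t| < γ)
    (hinc : ∀ᶠ t : ℕ in atTop, 1 / (t : ℝ) * (g t - ε t) ≤ φ (t + 1) - φ t) :
    Tendsto g atTop (𝓝 0) := by
  have hC : 0 ≤ C := by simpa using dist_nonneg.trans (hf 1 le_rfl)
  suffices h : ∀ γ > 0, ∀ᶠ t in atTop, g t < 3 * γ by
    refine tendsto_order.2 ⟨fun a ha => ?_, fun a ha => ?_⟩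
    · filter_upwards [eventually_ge_atTop 1] with t ht using ha.trans_le (hg t ht)
    · filter_upwards [h (a / 3) (by positivity)] with t ht
      linarith
  intro γ hγ
  obtain ⟨δ, hδ, hunif⟩ := hunif γ hγ
  -- During κt steps after t, f moves by less than δ, so g stays above 2γ if g t ≥ 3γ; κ ≤ 1 keeps
  -- the step lengths above 1/(2t). The total gain is at least γκ/4, against the Cauchy property.
  obtain ⟨κ, hκ, hκ1, hκδ⟩ : ∃ κ : ℝ, 0 < κ ∧ κ ≤ 1 ∧ C * κ < δ := by
    refine ⟨min 1 (δ / (2 * (C + 1))), by positivity, min_le_left _ _, ?_⟩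
    calc C * min 1 (δ / (2 * (C + 1))) ≤ (C + 1) * (δ / (2 * (C + 1))) := by
          gcongr
          · linarith
          · exact min_le_right _ _
      _ = δ / 2 := by field_simp
      _ < δ := by linarith
  obtain ⟨N, hN⟩ := Metric.cauchySeq_iff.1 hφ.cauchySeq (γ * κ / 4) (by positivity)
  obtain ⟨N', hN'⟩ := eventually_atTop.1 (((tendsto_order.1 hε).2 γ hγ).and hinc)
  filter_upwards [eventually_ge_atTop N, eventually_ge_atTop N', eventually_ge_atTop 1,
    tendsto_natCast_atTop_atTop.eventually_ge_atTop (1 / κ)] with t htN htN' ht1 htκ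
  by_contra! hgt
  have ht0 : (0 : ℝ) < t := by exact_mod_cast ht1
  have htκ' : 1 ≤ κ * t := by rwa [div_le_iff₀' hκ] at htκ
  set m := ⌊κ * t⌋₊ with hm
  have hmle : (m : ℝ) ≤ κ * t := Nat.floor_le (by positivity)
  have hmge : κ * t / 2 ≤ m := by
    have h1 : 1 ≤ m := Nat.one_le_floor_iff _ |>.2 htκ'
    have h2 : κ * t < m + 1 := Nat.lt_floor_add_one _
    have h3 : (1 : ℝ) ≤ m := by exact_mod_cast h1
    linarith
  have hdist : ∀ k : ℕ, dist (f t) (f (t + k)) ≤ C / t * k := by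
    intro k
    induction k with
    | zero => simp
    | succ k ih =>
      have h1 := hf (t + k) (by omega)
      have h2 : C / ((t + k : ℕ) : ℝ) ≤ C / t := by
        gcongr
        omega
      calc dist (f t) (f (t + (k + 1)))
          ≤ dist (f t) (f (t + k)) + dist (f (t + k)) (f (t + k + 1)) := dist_triangle _ _ _
        _ ≤ C / t * (k + 1 : ℕ) := by push_cast; linarith
  have hgk : ∀ k ≤ m, 2 * γ < g (t + k) := by
    intro k hk
    have h1 : C / t * k < δ := by
      calc C / t * k ≤ C / t * (κ * t) := by
            gcongr
            exact (Nat.cast_le.2 hk).trans hmle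
        _ = C * κ := by field_simp
        _ < δ := hκδ
    have h2 := hunif t (t + k) ht1 (by omega) ((hdist k).trans_lt h1)
    linarith [(abs_lt.1 h2).2]
  have hφk : ∀ k ≤ m, γ / (2 * t) * k ≤ φ (t + k) - φ t := by
    intro k
    induction k with
    | zero => simp
    | succ k ih =>
      intro hk
      have h2 := hgk k (by omega)
      obtain ⟨h3, h1⟩ := hN' (t + k) (by omega)
      have h4 : γ / (2 * t) ≤ 1 / ((t + k : ℕ) : ℝ) * (g (t + k) - ε (t + k)) := by
        have hk' : (k : ℝ) ≤ t := by
          have : (k : ℝ) ≤ m := by exact_mod_cast (by omega : k ≤ m)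
          nlinarith
        calc γ / (2 * t) = 1 / (2 * t) * γ := by ring
          _ ≤ 1 / ((t + k : ℕ) : ℝ) * (g (t + k) - ε (t + k)) := by
            gcongr
            · push_cast; linarith
            · linarith
      have h5 := ih (by omega)
      rw [← add_assoc]
      push_cast
      linarith
  have h1 := hφk m le_rfl
  have h2 := hN (t + m) (by omega) t htN
  rw [Real.dist_eq] at h2
  have h3 : γ * κ / 4 ≤ γ / (2 * t) * m := by
    calc γ * κ / 4 = γ / (2 * t) * (κ * t / 2) := by field_simp; ring
      _ ≤ _ := by gcongr
  linarith [(abs_lt.1 h2).2]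

/-- A continuous function on a compact set takes asymptotically equal values along
asymptotically equal sequences. -/
theorem IsCompact.tendsto_sub_of_tendsto_sub {E : Type*} [SeminormedAddCommGroup E] {K : Set E}
    (hK : IsCompact K) {F : E → ℝ} (hF : ContinuousOn F K) {x y : ℕ → E}
    (hx : ∀ᶠ t in atTop, x t ∈ K) (hy : ∀ᶠ t in atTop, y t ∈ K)
    (hxy : Tendsto (fun t => x t - y t) atTop (𝓝 0)) :
    Tendsto (fun t => F (x t) - F (y t)) atTop (𝓝 0) := by
  have hu := Metric.uniformContinuousOn_iff.1 (hK.uniformContinuousOn_of_continuous hF)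
  rw [Metric.tendsto_nhds]
  intro r hr
  obtain ⟨δ, hδ, h⟩ := hu r hr
  filter_upwards [hx, hy, Metric.tendsto_nhds.1 hxy δ hδ] with t h1 h2 h3
  rw [dist_zero_right, ← dist_eq_norm] at h3 ⊢
  exact h _ h1 _ h2 h3

/-- A continuous function which is positive on a compact set is bounded away from zero. -/
theorem IsCompact.exists_pos_forall_le {X : Type*} [TopologicalSpace X] {K : Set X}
    (hK : IsCompact K) {F : X → ℝ} (hF : ContinuousOn F K) (hpos : ∀ x ∈ K, 0 < F x) :
    ∃ γ > 0, ∀ x ∈ K, γ ≤ F x := by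
  rcases K.eq_empty_or_nonempty with rfl | hne
  · exact ⟨1, one_pos, by simp⟩
  · obtain ⟨x, hx, hmin⟩ := hK.exists_isMinOn hne hF
    exact ⟨F x, hpos x hx, fun y hy => hmin hy⟩

/-! ### Total variation convergence of beliefs -/

/-- Integrals of a bounded function converge along measures converging in total variation. -/
theorem DFP.tendsto_integral_of_tendsto_tv {Θ : Type*} [MeasurableSpace Θ]
    {μt : ℕ → ProbabilityMeasure Θ} {μ : ProbabilityMeasure Θ}
    (h : Tendsto (fun t => DFP.tv (μt t) μ) atTop (𝓝 0)) {u : Θ → ℝ} (hu : Measurable u) {C : ℝ}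
    (hC : ∀ θ, |u θ| ≤ C) :
    Tendsto (fun t => ∫ θ, u θ ∂(μt t : Measure Θ)) atTop (𝓝 (∫ θ, u θ ∂(μ : Measure Θ))) := by
  have hC0 : 0 ≤ C := by
    obtain ⟨θ⟩ := μ.nonempty
    exact (abs_nonneg _).trans (hC θ)
  have hint : ∀ ν : ProbabilityMeasure Θ, Integrable u (ν : Measure Θ) := fun ν =>
    .of_bound hu.aestronglyMeasurable C (.of_forall fun θ => by simpa using hC θ)
  -- Layer-cake formula for u + C ∈ [0, 2C]: the tail probabilities under two measures differ by at
  -- most their total variation distance, so the integrals differ by at most 2C times it.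
  have hlayer : ∀ ν : ProbabilityMeasure Θ, ∫ θ, u θ ∂(ν : Measure Θ) =
      (∫ s in Set.Ioc 0 (2 * C), (ν : Measure Θ).real {θ | s ≤ u θ + C}) - C := by
    intro ν
    have h1 : Integrable (fun θ => u θ + C) (ν : Measure Θ) := (hint ν).add (integrable_const C)
    rw [← h1.integral_eq_integral_Ioc_meas_le, integral_add (hint ν) (integrable_const C)]
    · simp
    · exact .of_forall fun θ => neg_le_iff_add_nonneg.1 (abs_le.1 (hC θ)).1
    · exact .of_forall fun θ => by
        have := (abs_le.1 (hC θ)).2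
        simp only
        linarith
  have hmeas : ∀ ν : ProbabilityMeasure Θ,
      IntegrableOn (fun s => (ν : Measure Θ).real {θ | s ≤ u θ + C}) (Set.Ioc 0 (2 * C)) := by
    intro ν
    refine Measure.integrableOn_of_bounded (M := 1) measure_Ioc_lt_top.ne ?_ (.of_forall fun s => ?_)
    · refine Measurable.aestronglyMeasurable (Antitone.measurable fun s s' hs => ?_)
      exact measureReal_mono fun θ hθ => hs.trans hθ
    · simp
  have hle : ∀ t (B : Set Θ), MeasurableSet B →
      |(μt t : Measure Θ).real B - (μ : Measure Θ).real B| ≤ DFP.tv (μt t) μ := by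
    intro t B hB
    refine le_ciSup (f := fun B : {B : Set Θ // MeasurableSet B} =>
      |(μt t : Measure Θ).real B - (μ : Measure Θ).real B|) ⟨1, ?_⟩ ⟨B, hB⟩
    rintro _ ⟨B', rfl⟩
    exact abs_sub_le_of_nonneg_of_le measureReal_nonneg measureReal_le_one measureReal_nonneg
      measureReal_le_one
  rw [tendsto_iff_norm_sub_tendsto_zero]
  refine squeeze_zero (fun _ => norm_nonneg _) (fun t => ?_)
    (by simpa using h.mul_const (2 * C))
  rw [hlayer, hlayer, sub_sub_sub_cancel_right, ← integral_sub (hmeas _) (hmeas _)]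
  refine (norm_setIntegral_le_of_norm_le_const (C := DFP.tv (μt t) μ) measure_Ioc_lt_top fun s _ =>
    hle t _ (measurableSet_le measurable_const (hu.add_const C))).trans ?_
  simp [measureReal_def, hC0]

/-! ### Consensus by averaging over the limit graph -/

namespace DFP

variable {ι : Type*} [Fintype ι] {G : ℕ → SimpleGraph ι} {w : ℕ → ι → ι → ι → ℝ} {η : ℝ}

/-- Averaging values bounded by `B`, one of which is at most `(1 - q) B + e`. -/
theorem WeightAssumption.sum_mul_le (hw : WeightAssumption G w η) {t : ℕ} {i j k : ι}
    (hij : j ≠ i) (hk : k = i ∨ (G t).Adj i k) {x : ι → ℝ} {B q e : ℝ} (hB : 0 ≤ B) (hq : 0 ≤ q)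
    (he : 0 ≤ e) (hx : ∀ l, x l ≤ B) (hxk : x k ≤ (1 - q) * B + e) :
    ∑ l, w t i j l * x l ≤ (1 - η * q) * B + e := by
  classical
  have h1 : ∑ l, w t i j l * x l ≤ ∑ l, w t i j l * B - w t i j k * (q * B - e) := by
    rw [← Finset.add_sum_erase _ _ (Finset.mem_univ k),
      ← Finset.add_sum_erase _ (fun l => w t i j l * B) (Finset.mem_univ k)]
    have h2 : ∑ l ∈ Finset.univ.erase k, w t i j l * x l ≤
        ∑ l ∈ Finset.univ.erase k, w t i j l * B :=
      Finset.sum_le_sum fun l _ => mul_le_mul_of_nonneg_left (hx l) (hw.nonneg t i j l)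
    have h3 := mul_le_mul_of_nonneg_left hxk (hw.nonneg t i j k)
    linarith
  have h4 : w t i j k ≤ 1 := by
    rw [← hw.sum_one t i j]
    exact Finset.single_le_sum (fun l _ => hw.nonneg t i j l) (Finset.mem_univ k)
  rw [← Finset.sum_mul, hw.sum_one] at h1
  have h5 := mul_le_mul_of_nonneg_right (hw.lower t i j k hij hk) (mul_nonneg hq hB)
  have h6 := mul_le_mul_of_nonneg_right h4 he
  linarith

variable {j : ι} {x : ℕ → ι → ℝ} {r : ℕ → ℝ}

/-- The value at a node joined to the anchored node `j` falls below any asymptotic bound `B` of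
all values by a definite proportion. -/
theorem WeightAssumption.eventually_le_of_walk (hw : WeightAssumption G w η) {T : ℕ}
    (hT : ∀ i k, (limitGraph G).Adj i k → ∀ s, ∃ τ < T, (G (s + τ)).Adj i k)
    (hj : ∀ᶠ t in atTop, x t j ≤ 0)
    (hstep : ∀ᶠ t in atTop, ∀ i, j ≠ i → x (t + 1) i ≤ ∑ k, w t i j k * x t k + r t)
    (hr : Tendsto r atTop (𝓝 0)) {B : ℝ} (hB0 : 0 ≤ B) (hB : ∀ᶠ t in atTop, ∀ i, x t i ≤ B)
    {i : ι} (p : (limitGraph G).Walk i j) {ε : ℝ} (hε : 0 < ε) :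
    ∀ᶠ t in atTop, x t i ≤ (1 - η ^ (T * p.length)) * B + ε := by
  have hη0 := hw.eta_pos
  have hη1 := hw.eta_lt_one
  induction p generalizing ε with
  | nil =>
    filter_upwards [hj] with t ht
    simpa using ht.trans hε.le
  | @cons i k j hik p ih =>
    by_cases hij : j = i
    · subst hij
      filter_upwards [hj] with t ht
      have h1 : η ^ (T * (SimpleGraph.Walk.cons hik p).length) ≤ 1 := pow_le_one₀ hη0.le hη1.le
      have h2 := mul_nonneg (sub_nonneg.2 h1) hB0
      linarith
    set c := η ^ (T * p.length) with hc
    have hc0 : 0 < c := by positivity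
    -- One error e comes from the neighbour's bound and one perturbation from each of at most T
    -- updates, hence T + 1 shares.
    have hε' : 0 < ε / (T + 1) := by positivity
    set e := ε / (T + 1) with he
    obtain ⟨N, hN⟩ := eventually_atTop.1
      (((ih hj hstep hε').and hB).and (hstep.and ((tendsto_order.1 hr).2 e hε')))
    filter_upwards [eventually_ge_atTop (N + T)] with s hs
    obtain ⟨τ, hτ, hadj⟩ := hT i k hik (s - T)
    -- The exchange with k passes on a fraction η of its saving; afterwards the self-weight
    -- preserves at least a fraction η at each update, until time s.
    have key : ∀ m, x (s - T + τ + 1 + m) i ≤ (1 - η ^ (m + 1) * c) * B + (m + 2) * e := by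
      intro m
      induction m with
      | zero =>
        obtain ⟨⟨h1, h2⟩, h3, h4⟩ := hN (s - T + τ) (by omega)
        have h5 := hw.sum_mul_le hij (Or.inr hadj) hB0 hc0.le hε'.le h2 h1
        have h6 := h3 i hij
        simp only [add_zero, zero_add, pow_one, CharP.cast_eq_zero]
        linarith
      | succ m ihm =>
        obtain ⟨⟨h1, h2⟩, h3, h4⟩ := hN (s - T + τ + 1 + m) (by omega)
        have h5 := hw.sum_mul_le (t := s - T + τ + 1 + m) (q := η ^ (m + 1) * c) hij
          (Or.inl rfl) hB0 (by positivity) (by positivity) h2 ihm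
        have h6 := h3 i hij
        rw [← mul_assoc, ← pow_succ'] at h5
        rw [← add_assoc]
        push_cast
        linarith
    have h1 := key (T - 1 - τ)
    have h2 : s - T + τ + 1 + (T - 1 - τ) = s := by omega
    rw [h2] at h1
    have h3 : η ^ (T * (SimpleGraph.Walk.cons hik p).length) ≤ η ^ (T - 1 - τ + 1) * c := by
      rw [hc, ← pow_add]
      refine pow_le_pow_of_le_one hη0.le hη1.le ?_
      rw [SimpleGraph.Walk.length_cons, mul_add, mul_one]
      omega
    have h4 : ((T - 1 - τ : ℕ) : ℝ) + 2 ≤ T + 1 := by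
      have : T - 1 - τ + 2 ≤ T + 1 := by omega
      exact_mod_cast this
    have h5 := mul_le_mul_of_nonneg_right h3 hB0
    have h6 := mul_le_mul_of_nonneg_right h4 hε'.le
    have h7 : (T + 1) * e = ε := by rw [he]; field_simp
    linarith

/-- Averaging over a connected limit graph with bounded intercommunication and one anchored node:
bounded values driven by vanishing perturbations become asymptotically nonpositive. -/
theorem WeightAssumption.eventually_lt_of_connected (hw : WeightAssumption G w η)
    (hconn : (limitGraph G).Connected) (hbdd : BoundedIntercommunication G)
    (hj : ∀ᶠ t in atTop, x t j ≤ 0)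
    (hstep : ∀ᶠ t in atTop, ∀ i, j ≠ i → x (t + 1) i ≤ ∑ k, w t i j k * x t k + r t)
    (hr : Tendsto r atTop (𝓝 0)) {B : ℝ} (hB : ∀ᶠ t in atTop, ∀ i, x t i ≤ B)
    {ε : ℝ} (hε : 0 < ε) : ∀ᶠ t in atTop, ∀ i, x t i < ε := by
  obtain ⟨T, -, hT⟩ := hbdd
  have hη0 := hw.eta_pos
  have hη1 := hw.eta_lt_one
  let p : ∀ i, (limitGraph G).Walk i j := fun i => (hconn.preconnected i j).some
  -- The sum of the walk lengths serves as one exponent valid for all nodes.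
  let q := η ^ (T * ∑ i, (p i).length)
  have hq0 : 0 < q := by positivity
  have hcontr : ∀ B ≥ 0, (∀ᶠ t in atTop, ∀ i, x t i ≤ B) → ∀ ε > 0,
      ∀ᶠ t in atTop, ∀ i, x t i ≤ (1 - q) * B + ε := by
    intro B hB0 hB ε hε
    rw [eventually_all]
    intro i
    filter_upwards [hw.eventually_le_of_walk hT hj hstep hr hB0 hB (p i) hε] with t ht
    have h1 : q ≤ η ^ (T * (p i).length) :=
      pow_le_pow_of_le_one hη0.le hη1.le (Nat.mul_le_mul_left _
        (Finset.single_le_sum (f := fun i => (p i).length) (fun _ _ => Nat.zero_le _)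
          (Finset.mem_univ i)))
    have h2 := mul_le_mul_of_nonneg_right h1 hB0
    linarith
  let S := {B : ℝ | 0 ≤ B ∧ ∀ᶠ t in atTop, ∀ i, x t i ≤ B}
  have hSne : S.Nonempty := ⟨max B 0, le_max_right _ _,
    hB.mono fun t ht i => (ht i).trans (le_max_left _ _)⟩
  have hSbdd : BddBelow S := ⟨0, fun B hB => hB.1⟩
  have hL0 : 0 ≤ sInf S := le_csInf hSne fun B hB => hB.1
  have hq1 : q ≤ 1 := pow_le_one₀ hη0.le hη1.le
  have hL : sInf S = 0 := by
    by_contra hne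
    have hLpos : 0 < sInf S := lt_of_le_of_ne hL0 (Ne.symm hne)
    obtain ⟨B', hB', hlt⟩ := exists_lt_of_csInf_lt hSne
      -- With slack qL/4 in both places, (1 - q)(L + qL/4) + qL/4 < L, contradicting minimality of
      -- the infimum L.
      (show sInf S < sInf S + q * sInf S / 4 by linarith [mul_pos hq0 hLpos])
    have h1 := hcontr B' hB'.1 hB'.2 (q * sInf S / 4) (by positivity)
    have h2 : sInf S ≤ (1 - q) * B' + q * sInf S / 4 :=
      csInf_le hSbdd ⟨by have := mul_nonneg (sub_nonneg.2 hq1) hB'.1; positivity, h1⟩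
    have h3 := mul_le_mul_of_nonneg_left hlt.le (sub_nonneg.2 hq1)
    nlinarith [mul_pos hq0 hLpos, mul_pos hq0 (mul_pos hq0 hLpos)]
  obtain ⟨B', hB', hlt⟩ := exists_lt_of_csInf_lt hSne (hL.trans_lt hε)
  exact hB'.2.mono fun t ht i => (ht i).trans_lt hlt

end DFP

/-! ### Equilibria and the deviation gap -/

namespace DFP

theorem Psi_mem_stdSimplex {α : Type*} [Fintype α] [DecidableEq α] (b : α) :
    Psi b ∈ stdSimplex ℝ α :=
  ⟨fun c => by unfold Psi; split_ifs <;> norm_num, by simp [Psi]⟩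

variable {ι : Type*} {A : ι → Type*} [∀ i, Fintype (A i)]

/-- The set of mixed strategy profiles. -/
def profiles (A : ι → Type*) [∀ i, Fintype (A i)] : Set (∀ i, A i → ℝ) :=
  Set.univ.pi fun i => stdSimplex ℝ (A i)

theorem mem_profiles {σ : ∀ i, A i → ℝ} : σ ∈ profiles A ↔ ∀ i, σ i ∈ stdSimplex ℝ (A i) := by
  simp [profiles]

theorem isCompact_profiles : IsCompact (profiles A) :=
  isCompact_univ_pi fun i => isCompact_stdSimplex ℝ (A i)

theorem convex_profiles : Convex ℝ (profiles A) :=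
  convex_pi fun i _ => convex_stdSimplex ℝ (A i)

theorem update_mem_profiles [DecidableEq ι] [∀ i, DecidableEq (A i)] {σ : ∀ i, A i → ℝ}
    (hσ : σ ∈ profiles A) (i : ι) (b : A i) : Function.update σ i (Psi b) ∈ profiles A := by
  rw [mem_profiles] at hσ ⊢
  intro k
  by_cases h : k = i
  · subst h
    simpa using Psi_mem_stdSimplex b
  · simpa [h] using hσ k

variable [Fintype ι]

theorem continuous_profileDist (τ : ∀ i, A i → ℝ) :
    Continuous fun σ : ∀ i, A i → ℝ => profileDist τ σ := by
  unfold profileDist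
  fun_prop

theorem profileDist_comm (σ τ : ∀ i, A i → ℝ) : profileDist σ τ = profileDist τ σ := by
  simp only [profileDist, sub_sq_comm]

variable [DecidableEq ι]

theorem expPayoff_eq_potential {Θ : Type*} [MeasurableSpace Θ] {u : (∀ i, A i) → Θ → ℝ}
    {ν : ProbabilityMeasure Θ} (hu : ∀ a, Integrable (u a) (ν : Measure Θ))
    (σ : ∀ i, A i → ℝ) :
    expPayoff u ν σ = potential (fun a => ∫ θ, u a θ ∂(ν : Measure Θ)) σ := by
  simp only [expPayoff, mixedPayoff, potential_apply]
  rw [integral_finsetSum _ fun a _ => (hu a).mul_const _]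
  simp only [integral_mul_const]

variable [∀ i, DecidableEq (A i)]

/-- Linearity in one's own strategy reduces mixed deviations to pure ones. -/
theorem potential_update_eq_sum (c : (∀ i, A i) → ℝ) (σ : ∀ i, A i → ℝ) (i : ι) (s : A i → ℝ) :
    potential c (Function.update σ i s) =
      ∑ b, s b * potential c (Function.update σ i (Psi b)) := by
  have hs : s = ∑ b, s b • Psi b := by
    ext b
    simp [Psi]
  conv_lhs => rw [hs]
  refine ((potential c).toMultilinearMap.map_update_sum Finset.univ i _ σ).trans ?_
  refine Finset.sum_congr rfl fun b _ => ?_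
  exact ((potential c).map_update_smul σ i (s b) (Psi b)).trans (smul_eq_mul _ _)

/-- The mixed equilibria of the game in which every player has the payoff `c`. -/
def equilibria (c : (∀ i, A i) → ℝ) : Set (∀ i, A i → ℝ) :=
  {σ | σ ∈ profiles A ∧
    ∀ i (b : A i), potential c (Function.update σ i (Psi b)) ≤ potential c σ}

theorem nashSet_eq_equilibria {Θ : Type*} [MeasurableSpace Θ] {u : (∀ i, A i) → Θ → ℝ}
    {ν : ProbabilityMeasure Θ} (hu : ∀ a, Integrable (u a) (ν : Measure Θ)) :
    nashSet u ν = equilibria (fun a => ∫ θ, u a θ ∂(ν : Measure Θ)) := by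
  ext σ
  simp only [nashSet, equilibria, Set.mem_ofPred_eq, mem_profiles, expPayoff_eq_potential hu]
  refine and_congr_right fun hσ => forall_congr' fun i => ⟨fun h b => h _ (Psi_mem_stdSimplex b),
    fun h s hs => ?_⟩
  rw [potential_update_eq_sum]
  calc _ ≤ ∑ b, s b * potential (fun a => ∫ θ, u a θ ∂(ν : Measure Θ)) σ :=
        Finset.sum_le_sum fun b _ => mul_le_mul_of_nonneg_left (h b) (hs.1 b)
    _ = _ := by rw [← Finset.sum_mul, hs.2, one_mul]

/-- At an equilibrium the nonnegative losses of a player's actions average to zero, so every action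
in the support is a best response: the indifference condition of `finite_image_potential`. -/
theorem finite_image_equilibria (c : (∀ i, A i) → ℝ) : (potential c '' equilibria c).Finite := by
  refine finite_image_potential c _ (fun σ hσ i => (mem_profiles.1 hσ.1 i).2) ?_
  rintro σ ⟨hσ, hle⟩ i b hb
  have hσi := mem_profiles.1 hσ i
  have h1 : ∑ b, σ i b * (potential c σ - potential c (Function.update σ i (Psi b))) = 0 := by
    simp only [mul_sub, Finset.sum_sub_distrib]
    rw [← potential_update_eq_sum, Function.update_eq_self, ← Finset.sum_mul, hσi.2, one_mul,
      sub_self]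
  have h2 := (Finset.sum_eq_zero_iff_of_nonneg fun b _ =>
    mul_nonneg (hσi.1 b) (sub_nonneg.2 (hle i b))).1 h1 b (Finset.mem_univ b)
  rcases mul_eq_zero.1 h2 with h | h
  · exact absurd h hb
  · exact (sub_eq_zero.1 h).symm

theorem continuous_potential_update (c : (∀ i, A i) → ℝ) (i : ι) (b : A i) :
    Continuous fun σ : ∀ i, A i → ℝ => potential c (Function.update σ i (Psi b)) :=
  (potential c).cont.comp (continuous_id.update i continuous_const)

theorem isCompact_equilibria (c : (∀ i, A i) → ℝ) : IsCompact (equilibria c) := by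
  have h : equilibria c = profiles A ∩
      ⋂ (i) (b : A i), {σ | potential c (Function.update σ i (Psi b)) ≤ potential c σ} := by
    ext σ
    simp [equilibria]
  rw [h]
  exact isCompact_profiles.inter_right <| isClosed_iInter fun i => isClosed_iInter fun b =>
    isClosed_le (continuous_potential_update c i b) (potential c).cont

section Gap

variable [∀ i, Nonempty (A i)]

/-- With a common payoff no fixed point argument is needed: a global maximizer is an equilibrium. -/
theorem equilibria_nonempty (c : (∀ i, A i) → ℝ) : (equilibria c).Nonempty := by
  have hne : (profiles A).Nonempty :=
    ⟨fun i => Psi (Classical.arbitrary (A i)), mem_profiles.2 fun i => Psi_mem_stdSimplex _⟩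
  obtain ⟨σ, hσ, hmax⟩ := isCompact_profiles.exists_isMaxOn hne (potential c).cont.continuousOn
  exact ⟨σ, hσ, fun i b => hmax (update_mem_profiles hσ i b)⟩

/-- The payoff of a best response of player `i` to the profile `σ`. -/
noncomputable def bestValue (c : (∀ i, A i) → ℝ) (i : ι) (σ : ∀ i, A i → ℝ) : ℝ :=
  Finset.univ.sup' Finset.univ_nonempty
    (fun b : A i => potential c (Function.update σ i (Psi b)))

theorem le_bestValue (c : (∀ i, A i) → ℝ) (i : ι) (σ : ∀ i, A i → ℝ) (b : A i) :
    potential c (Function.update σ i (Psi b)) ≤ bestValue c i σ :=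
  Finset.le_sup' (fun b : A i => potential c (Function.update σ i (Psi b))) (Finset.mem_univ b)

theorem bestValue_le (c : (∀ i, A i) → ℝ) (i : ι) (σ : ∀ i, A i → ℝ) {x : ℝ}
    (h : ∀ b : A i, potential c (Function.update σ i (Psi b)) ≤ x) : bestValue c i σ ≤ x :=
  Finset.sup'_le _ _ fun b _ => h b

/-- The total gain available to the players from unilateral deviations. -/
noncomputable def gap (c : (∀ i, A i) → ℝ) (σ : ∀ i, A i → ℝ) : ℝ :=
  ∑ i, (bestValue c i σ - potential c σ)

theorem continuous_gap (c : (∀ i, A i) → ℝ) : Continuous (gap c) :=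
  continuous_finsetSum _ fun i _ =>
    (Continuous.finset_sup'_apply _ fun b _ => continuous_potential_update c i b).sub
      (potential c).cont

theorem potential_le_bestValue (c : (∀ i, A i) → ℝ) {σ : ∀ i, A i → ℝ} (hσ : σ ∈ profiles A)
    (i : ι) : potential c σ ≤ bestValue c i σ := by
  have hσi := mem_profiles.1 hσ i
  calc potential c σ = ∑ b, σ i b * potential c (Function.update σ i (Psi b)) := by
        rw [← potential_update_eq_sum, Function.update_eq_self]
    _ ≤ ∑ b, σ i b * bestValue c i σ :=
        Finset.sum_le_sum fun b _ => mul_le_mul_of_nonneg_left (le_bestValue c i σ b) (hσi.1 b)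
    _ = bestValue c i σ := by rw [← Finset.sum_mul, hσi.2, one_mul]

theorem gap_nonneg (c : (∀ i, A i) → ℝ) {σ : ∀ i, A i → ℝ} (hσ : σ ∈ profiles A) : 0 ≤ gap c σ :=
  Finset.sum_nonneg fun i _ => sub_nonneg.2 (potential_le_bestValue c hσ i)

theorem gap_pos (c : (∀ i, A i) → ℝ) {σ : ∀ i, A i → ℝ} (hσ : σ ∈ profiles A)
    (h : σ ∉ equilibria c) : 0 < gap c σ := by
  refine lt_of_le_of_ne (gap_nonneg c hσ) fun h0 => h ⟨hσ, fun i b => ?_⟩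
  have h1 := (Finset.sum_eq_zero_iff_of_nonneg fun i _ =>
    sub_nonneg.2 (potential_le_bestValue c hσ i)).1 h0.symm i (Finset.mem_univ i)
  exact (le_bestValue c i σ b).trans_eq (sub_eq_zero.1 h1)

end Gap

end DFP

/-! ### Growth of the potential along averaged best responses -/

namespace DFP

variable {ι : Type*} [Fintype ι] [DecidableEq ι] {A : ι → Type*} [∀ i, Fintype (A i)]

/-- First-order expansion of the potential along averaging steps of length `1 / t`. -/
theorem exists_potential_increment_eq (c : (∀ i, A i) → ℝ) {f y : ℕ → ∀ i, A i → ℝ}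
    (hf : ∀ t, 1 ≤ t → f t ∈ profiles A) (hy : ∀ t, y t ∈ profiles A)
    (hupd : ∀ t, 1 ≤ t → f (t + 1) = f t + (1 / (t : ℝ)) • (y t - f t))
    (hstep : Tendsto (fun t => f (t + 1) - f t) atTop (𝓝 0)) :
    ∃ ε : ℕ → ℝ, Tendsto ε atTop (𝓝 0) ∧ ∀ t : ℕ, 1 ≤ t →
      potential c (f (t + 1)) - potential c (f t) = 1 / (t : ℝ) *
        (∑ i, (potential c (Function.update (f t) i (y t i)) - potential c (f t)) - ε t) := by
  let F : (∀ i, A i → ℝ) × (∀ i, A i → ℝ) → ℝ := fun z => (potential c).linearDeriv z.1 z.2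
  have hFeq : ∀ σ s, F (σ, s) = ∑ i, potential c (Function.update σ i (s i)) := fun σ s =>
    (potential c).linearDeriv_apply σ s
  have hF : Continuous F := by
    have : F = fun z => ∑ i, potential c (Function.update z.1 i (z.2 i)) := by
      ext z
      exact hFeq z.1 z.2
    rw [this]
    refine continuous_finsetSum _ fun i _ => (potential c).cont.comp ?_
    exact continuous_fst.update i ((continuous_apply i).comp continuous_snd)
  -- Mean value theorem on the segment from f t to f (t + 1); uniform continuity then lets f t
  -- replace the intermediate point with error o(1).
  have hmv : ∀ t, ∃ s ∈ Set.Ioo (0 : ℝ) 1,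
      F (f t + s • (f (t + 1) - f t), f (t + 1) - f t) =
        potential c (f (t + 1)) - potential c (f t) := by
    intro t
    have hd : ∀ s : ℝ, HasDerivAt (fun s : ℝ => potential c (f t + s • (f (t + 1) - f t)))
        (F (f t + s • (f (t + 1) - f t), f (t + 1) - f t)) s := by
      intro s
      have h1 : HasDerivAt (fun s : ℝ => f t + s • (f (t + 1) - f t)) (f (t + 1) - f t) s := by
        simpa using ((hasDerivAt_id s).smul_const (f (t + 1) - f t)).const_add (f t)
      exact ((potential c).hasFDerivAt _).comp_hasDerivAt s h1
    obtain ⟨s, hs, h⟩ := exists_hasDerivAt_eq_slope _ _ one_pos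
      (fun s _ => (hd s).continuousAt.continuousWithinAt) (fun s _ => hd s)
    exact ⟨s, hs, by simpa using h⟩
  choose s hs hslope using hmv
  let σ : ℕ → ∀ i, A i → ℝ := fun t => f t + s t • (f (t + 1) - f t)
  have hσ : ∀ t, 1 ≤ t → σ t ∈ profiles A := fun t ht =>
    convex_profiles.add_smul_sub_mem (hf t ht) (hf (t + 1) (by omega)) ⟨(hs t).1.le, (hs t).2.le⟩
  have hσf : Tendsto (fun t => f t - σ t) atTop (𝓝 0) := by
    refine squeeze_zero_norm (fun t => ?_) (tendsto_zero_iff_norm_tendsto_zero.1 hstep)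
    simp only [σ, sub_add_cancel_left, norm_neg, norm_smul]
    refine mul_le_of_le_one_left (norm_nonneg _) ?_
    rw [Real.norm_eq_abs, abs_of_pos (hs t).1]
    exact (hs t).2.le
  have hlim : ∀ z : ℕ → ∀ i, A i → ℝ, (∀ t, 1 ≤ t → z t ∈ profiles A) →
      Tendsto (fun t => F (f t, z t) - F (σ t, z t)) atTop (𝓝 0) := by
    intro z hz
    refine (isCompact_profiles.prod isCompact_profiles).tendsto_sub_of_tendsto_sub
      hF.continuousOn ?_ ?_ ?_
    · filter_upwards [eventually_ge_atTop 1] with t ht using ⟨hf t ht, hz t ht⟩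
    · filter_upwards [eventually_ge_atTop 1] with t ht using ⟨hσ t ht, hz t ht⟩
    · have := hσf.prodMk_nhds (tendsto_const_nhds (x := (0 : ∀ i, A i → ℝ)))
      simpa [Prod.mk_zero_zero] using this
  refine ⟨_, by simpa using (hlim y fun t _ => hy t).sub (hlim f hf), fun t ht => ?_⟩
  have h1 : F (f t, f t) = ∑ i : ι, potential c (f t) := by
    rw [hFeq]
    simp only [Function.update_eq_self]
  rw [← hslope t, Finset.sum_sub_distrib, ← hFeq, ← h1]
  have h2 : F (σ t, f (t + 1) - f t) = 1 / (t : ℝ) * (F (σ t, y t) - F (σ t, f t)) := by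
    have : f (t + 1) - f t = (1 / (t : ℝ)) • (y t - f t) := by
      rw [hupd t ht, add_sub_cancel_left]
    simp only [F, this, map_smul, map_sub, smul_eq_mul]
  change F (σ t, f (t + 1) - f t) = _
  rw [h2]
  ring

variable [∀ i, DecidableEq (A i)]

/-- If the sequence `f` averages asymptotic best responses to itself in a game with common payoff
`c`, then the gain available from unilateral deviations from `f` vanishes. -/
theorem tendsto_gap_of_asymptotic_best_response [∀ i, Nonempty (A i)] (c : (∀ i, A i) → ℝ)
    {f y : ℕ → ∀ i, A i → ℝ} {e : ℕ → ℝ}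
    (hf : ∀ t, 1 ≤ t → f t ∈ profiles A) (hy : ∀ t, y t ∈ profiles A)
    (hupd : ∀ t, 1 ≤ t → f (t + 1) = f t + (1 / (t : ℝ)) • (y t - f t))
    (hdist : ∀ t, 1 ≤ t → dist (f t) (f (t + 1)) ≤ 1 / t)
    (he : Tendsto e atTop (𝓝 0))
    (hbr : ∀ᶠ t in atTop, ∀ i, bestValue c i (f t) ≤
      potential c (Function.update (f t) i (y t i)) + e t) :
    Tendsto (fun t => gap c (f t)) atTop (𝓝 0) := by
  have hstep : Tendsto (fun t => f (t + 1) - f t) atTop (𝓝 0) := by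
    refine squeeze_zero_norm' ?_ tendsto_one_div_atTop_nhds_zero_nat
    filter_upwards [eventually_ge_atTop 1] with t ht
    simpa [dist_eq_norm, norm_sub_rev] using hdist t ht
  obtain ⟨ε, hε, hεeq⟩ := exists_potential_increment_eq c hf hy hupd hstep
  let ε' : ℕ → ℝ := fun t => ε t + Fintype.card ι * e t
  have hε' : Tendsto ε' atTop (𝓝 0) := by simpa using hε.add (he.const_mul (Fintype.card ι : ℝ))
  have hinc : ∀ᶠ t : ℕ in atTop, 1 / (t : ℝ) * (gap c (f t) - ε' t) ≤
      potential c (f (t + 1)) - potential c (f t) := by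
    filter_upwards [eventually_ge_atTop 1, hbr] with t ht hbrt
    rw [hεeq t ht]
    have h1 : gap c (f t) ≤
        ∑ i, (potential c (Function.update (f t) i (y t i)) - potential c (f t) + e t) :=
      Finset.sum_le_sum fun i _ => by linarith [hbrt i]
    rw [Finset.sum_add_distrib, Finset.sum_const, Finset.card_univ, nsmul_eq_mul] at h1
    refine mul_le_mul_of_nonneg_left ?_ (by positivity)
    simp only [ε']
    linarith
  have hmem : ∀ᶠ t in atTop, f t ∈ profiles A := by
    filter_upwards [eventually_ge_atTop 1] with t ht using hf t ht
  have hmem' : ∀ᶠ t in atTop, f (t + 1) ∈ profiles A := .of_forall fun t => hf _ (by omega)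
  obtain ⟨B, hB⟩ := isCompact_profiles.exists_bound_of_continuousOn (potential c).cont.continuousOn
  obtain ⟨l, hl⟩ : ∃ l, Tendsto (fun t => potential c (f t)) atTop (𝓝 l) := by
    refine exists_tendsto_of_eventually_le_succ (B := B) (V := potential c '' equilibria c)
      (hmem.mono fun t ht => hB _ ht) (finite_image_equilibria c)
      (isCompact_profiles.tendsto_sub_of_tendsto_sub (potential c).cont.continuousOn hmem' hmem
        hstep) fun x hx => ?_
    -- Profiles with potential within r of x form a compact set free of equilibria, where the gap
    -- has a positive minimum that eventually dominates the error.
    obtain ⟨r, hr, hrV⟩ := Metric.nhds_basis_closedBall.mem_iff.1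
      ((finite_image_equilibria c).isClosed.isOpen_compl.mem_nhds hx)
    obtain ⟨γ, hγ, hγle⟩ := (isCompact_profiles.inter_right
      (Metric.isClosed_closedBall.preimage (potential c).cont :
        IsClosed (potential c ⁻¹' Metric.closedBall x r))).exists_pos_forall_le
      (continuous_gap c).continuousOn
      (fun σ hσ => gap_pos c hσ.1 fun h => hrV hσ.2 ⟨σ, h, rfl⟩)
    refine ⟨r, hr, ?_⟩
    filter_upwards [eventually_ge_atTop 1, (tendsto_order.1 hε').2 γ hγ, hinc] with t ht h1 hinct h2
    have h3 := hγle (f t) ⟨hf t ht, by simpa [Real.dist_eq] using h2⟩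
    have h4 : 0 ≤ 1 / (t : ℝ) * (gap c (f t) - ε' t) :=
      mul_nonneg (by positivity) (by linarith)
    linarith
  refine tendsto_zero_of_increment_ge hl (fun t ht => gap_nonneg c (hf t ht)) hε' hdist ?_ hinc
  intro γ hγ
  obtain ⟨δ, hδ, h⟩ := Metric.uniformContinuousOn_iff.1
    (isCompact_profiles.uniformContinuousOn_of_continuous (continuous_gap c).continuousOn) γ hγ
  exact ⟨δ, hδ, fun s t hs ht hst => h _ (hf s hs) _ (hf t ht) hst⟩

/-- A sequence of profiles whose gap vanishes converges to the set of equilibria. -/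
theorem tendsto_dist_equilibria_of_tendsto_gap [∀ i, Nonempty (A i)] (c : (∀ i, A i) → ℝ)
    {f : ℕ → ∀ i, A i → ℝ} (hf : ∀ t, 1 ≤ t → f t ∈ profiles A)
    (hgap : Tendsto (fun t => gap c (f t)) atTop (𝓝 0)) :
    ∃ δ : ℕ → ℝ,
      (∀ t, IsLeast ((fun σ => profileDist (f t) σ) '' equilibria c) (δ t)) ∧
      Tendsto δ atTop (𝓝 0) := by
  have hleast : ∀ t, IsLeast ((fun σ => profileDist (f t) σ) '' equilibria c)
      (sInf ((fun σ => profileDist (f t) σ) '' equilibria c)) := fun t =>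
    ((isCompact_equilibria c).image (continuous_profileDist (f t))).isLeast_sInf
      ((equilibria_nonempty c).image _)
  refine ⟨_, hleast, tendsto_order.2 ⟨fun x hx => .of_forall fun t => ?_, fun x hx => ?_⟩⟩
  · obtain ⟨σ, -, hσ⟩ := (hleast t).1
    rw [← hσ]
    exact hx.trans_le (Real.sqrt_nonneg _)
  -- On the compact set of profiles at distance at least x from every equilibrium the gap is bounded
  -- below, so f eventually leaves it.
  · have hclosed : IsClosed (⋂ τ ∈ equilibria c, {σ | x ≤ profileDist τ σ}) :=
      isClosed_biInter fun τ _ => isClosed_le continuous_const (continuous_profileDist τ)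
    obtain ⟨γ, hγ, hγle⟩ := (isCompact_profiles.inter_right hclosed).exists_pos_forall_le
      (continuous_gap c).continuousOn (fun σ hσ => gap_pos c hσ.1 fun h => by
        have h1 : x ≤ profileDist σ σ := Set.mem_iInter₂.1 hσ.2 σ h
        have h2 : profileDist σ σ = 0 := by simp [profileDist]
        linarith)
    filter_upwards [eventually_ge_atTop 1, (tendsto_order.1 hgap).2 γ hγ] with t ht h1
    by_contra! h2
    refine h1.not_ge (hγle (f t) ⟨hf t ht, Set.mem_iInter₂.2 fun τ hτ => ?_⟩)
    change x ≤ profileDist τ (f t)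
    rw [profileDist_comm]
    exact h2.trans ((hleast t).2 ⟨τ, hτ, rfl⟩)

end DFP

/-! ### Runs of the algorithm -/

namespace DFP

variable {ι : Type*} [Fintype ι] [DecidableEq ι] {A : ι → Type*} [∀ i, Fintype (A i)]
  [∀ i, DecidableEq (A i)] {Θ : Type*} [MeasurableSpace Θ] {u : (∀ i, A i) → Θ → ℝ}
  {w : ℕ → ι → ι → ι → ℝ} {μt : ℕ → ι → ProbabilityMeasure Θ} {d : ℕ} {a : ℕ → ∀ i, A i}
  {f : ℕ → ∀ i, A i → ℝ} {v : ℕ → ι → ∀ j, A j → ℝ}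

namespace IsRun

theorem freq_mem_profiles (h : IsRun u w μt d a f v) : ∀ t, 1 ≤ t → f t ∈ profiles A := by
  intro t ht
  rw [mem_profiles]
  intro i
  induction t, ht using Nat.le_induction with
  | base =>
    rw [h.init_freq]
    exact Psi_mem_stdSimplex _
  | succ t ht ih =>
    rw [h.freq_update t ht]
    have ht' : (1 : ℝ) ≤ t := by exact_mod_cast ht
    exact (convex_stdSimplex ℝ (A i)).add_smul_sub_mem ih (Psi_mem_stdSimplex _)
      ⟨by positivity, by rw [div_le_one (by positivity)]; exact ht'⟩

theorem dist_freq_le (h : IsRun u w μt d a f v) :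
    ∀ t, 1 ≤ t → dist (f t) (f (t + 1)) ≤ 1 / t := by
  intro t ht
  rw [dist_pi_le_iff (by positivity)]
  intro i
  rw [dist_pi_le_iff (by positivity)]
  intro b
  have h1 := mem_Icc_of_mem_stdSimplex (mem_profiles.1 (h.freq_mem_profiles t ht) i) b
  have h2 := mem_Icc_of_mem_stdSimplex (Psi_mem_stdSimplex (a t i)) b
  rw [h.freq_update t ht, dist_comm, Real.dist_eq]
  simp only [Pi.add_apply, Pi.smul_apply, Pi.sub_apply, smul_eq_mul, add_sub_cancel_left, abs_mul]
  rw [abs_of_nonneg (by positivity)]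
  refine mul_le_of_le_one_right (by positivity) ?_
  exact abs_sub_le_of_nonneg_of_le h2.1 h2.2 h1.1 h1.2

theorem estimate_mem_profiles {G : ℕ → SimpleGraph ι} {η : ℝ} (h : IsRun u w μt d a f v)
    (hw : WeightAssumption G w η) : ∀ t, 1 ≤ t → ∀ i, v t i ∈ profiles A := by
  intro t ht
  induction t, ht using Nat.le_induction with
  | base =>
    intro i
    have : v 1 i = f 1 := funext fun j => h.init_estimate i j
    rw [this]
    exact h.freq_mem_profiles 1 le_rfl
  | succ t ht ih =>
    intro i
    rw [mem_profiles]
    intro j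
    by_cases hij : j = i
    · subst hij
      rw [h.own_estimate (t + 1) (by omega)]
      exact mem_profiles.1 (h.freq_mem_profiles (t + 1) (by omega)) j
    · rw [h.estimate_update t ht i j hij]
      refine (convex_stdSimplex ℝ (A j)).sum_mem (fun k _ => hw.nonneg t i j k)
        (hw.sum_one t i j) fun k _ => ?_
      split_ifs
      · exact mem_profiles.1 (h.freq_mem_profiles (t + d) (by omega)) j
      · exact mem_profiles.1 (ih k) j

/-- All estimates track the empirical frequencies. -/
theorem tendsto_estimate_sub_freq {G : ℕ → SimpleGraph ι} {η : ℝ} (h : IsRun u w μt d a f v)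
    (hd : d = 0 ∨ d = 1) (hw : WeightAssumption G w η) (hconn : (limitGraph G).Connected)
    (hbdd : BoundedIntercommunication G) (i j : ι) :
    Tendsto (fun t => v t i j - f t j) atTop (𝓝 0) := by
  let x : ℕ → ι → ℝ := fun t k => ‖v t k j - f t j‖
  have hfstep : ∀ t, 1 ≤ t → ‖f t j - f (t + 1) j‖ ≤ 1 / t := fun t ht => by
    rw [← dist_eq_norm]
    exact (dist_le_pi_dist _ _ j).trans (h.dist_freq_le t ht)
  have hj : ∀ᶠ t in atTop, x t j ≤ 0 := by
    filter_upwards [eventually_ge_atTop 1] with t ht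
    simp [x, h.own_estimate t ht]
  have hB : ∀ᶠ t in atTop, ∀ k, x t k ≤ 1 := by
    filter_upwards [eventually_ge_atTop 1] with t ht k
    rw [pi_norm_le_iff_of_nonneg zero_le_one]
    intro b
    have h1 := mem_Icc_of_mem_stdSimplex (mem_profiles.1 (h.estimate_mem_profiles hw t ht k) j) b
    have h2 := mem_Icc_of_mem_stdSimplex (mem_profiles.1 (h.freq_mem_profiles t ht) j) b
    exact abs_sub_le_of_nonneg_of_le h1.1 h1.2 h2.1 h2.2
  have hstep : ∀ᶠ t : ℕ in atTop, ∀ i, j ≠ i →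
      x (t + 1) i ≤ ∑ k, w t i j k * x t k + 2 * (1 / (t : ℝ)) := by
    filter_upwards [eventually_ge_atTop 1] with t ht i hij
    -- Transmitting f (t + 1) j instead of f t j costs at most 1/t; the drift of f itself costs
    -- another 1/t.
    have hterm : ∀ k, ‖(if k = j then f (t + d) j else v t k j) - f t j‖ ≤ x t k + 1 / t := by
      intro k
      split_ifs with hk
      · refine le_add_of_nonneg_of_le (norm_nonneg _) ?_
        rcases hd with rfl | rfl
        · simp
        · rw [norm_sub_rev]
          exact hfstep t ht
      · exact le_add_of_nonneg_right (by positivity)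
    have heq : v (t + 1) i j - f (t + 1) j =
        ∑ k, w t i j k • ((if k = j then f (t + d) j else v t k j) - f t j) +
          (f t j - f (t + 1) j) := by
      simp only [smul_sub]
      rw [h.estimate_update t ht i j hij, Finset.sum_sub_distrib, ← Finset.sum_smul,
        hw.sum_one, one_smul]
      abel
    calc x (t + 1) i ≤ ∑ k, w t i j k * (x t k + 1 / t) + 1 / t := by
          simp only [x]
          rw [heq]
          refine (norm_add_le _ _).trans (add_le_add ((norm_sum_le _ _).trans
            (Finset.sum_le_sum fun k _ => ?_)) (hfstep t ht))
          rw [norm_smul, Real.norm_of_nonneg (hw.nonneg t i j k)]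
          exact mul_le_mul_of_nonneg_left (hterm k) (hw.nonneg t i j k)
      _ = ∑ k, w t i j k * x t k + 2 * (1 / (t : ℝ)) := by
          simp only [mul_add, Finset.sum_add_distrib, ← Finset.sum_mul, hw.sum_one]
          ring
  have hr : Tendsto (fun t : ℕ => 2 * (1 / (t : ℝ))) atTop (𝓝 0) := by
    simpa using tendsto_one_div_atTop_nhds_zero_nat.const_mul (2 : ℝ)
  rw [tendsto_zero_iff_norm_tendsto_zero]
  refine tendsto_order.2 ⟨fun ε hε => .of_forall fun t => hε.trans_le (norm_nonneg _),
    fun ε hε => ?_⟩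
  filter_upwards [hw.eventually_lt_of_connected hconn hbdd hj hstep hr hB hε] with t ht using ht i

/-- The actions are asymptotically best responses to the empirical frequencies in the game with
the limit state belief. -/
theorem exists_asymptotic_best_response [∀ i, Nonempty (A i)] {G : ℕ → SimpleGraph ι} {η : ℝ}
    {μ : ProbabilityMeasure Θ} (h : IsRun u w μt d a f v) (hu_meas : ∀ a, Measurable (u a))
    (hu_bdd : ∀ a, ∃ C : ℝ, ∀ θ, |u a θ| ≤ C) (hw : WeightAssumption G w η)
    (hv : ∀ i j, Tendsto (fun t => v t i j - f t j) atTop (𝓝 0))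
    (hμ : ∀ i, Tendsto (fun t => tv (μt t i) μ) atTop (𝓝 0)) :
    ∃ e : ℕ → ℝ, Tendsto e atTop (𝓝 0) ∧ ∀ᶠ t in atTop, ∀ i,
      bestValue (fun a => ∫ θ, u a θ ∂(μ : Measure Θ)) i (f t) ≤
        potential (fun a => ∫ θ, u a θ ∂(μ : Measure Θ))
          (Function.update (f t) i (Psi (a t i))) + e t := by
  choose C hC using hu_bdd
  have hint : ∀ (ν : ProbabilityMeasure Θ) a, Integrable (u a) (ν : Measure Θ) := fun ν a =>
    .of_bound (hu_meas a).aestronglyMeasurable (C a)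
      (.of_forall fun θ => by simpa using hC a θ)
  let c : ProbabilityMeasure Θ → (∀ i, A i) → ℝ := fun ν a => ∫ θ, u a θ ∂(ν : Measure Θ)
  have hcC : ∀ ν, c ν ∈ Set.univ.pi fun a => Set.Icc (-C a) (C a) := fun ν a _ => by
    have h1 := norm_integral_le_of_norm_le_const (f := u a) (μ := (ν : Measure Θ)) (.of_forall (hC a))
    exact abs_le.1 (by simpa using h1)
  let F : ((∀ i, A i) → ℝ) × (∀ i, A i → ℝ) → ℝ := fun z => potential z.1 z.2
  have hF : Continuous F := by
    simp only [F, potential_apply]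
    fun_prop
  let e : ℕ → ∀ i, A i → ℝ := fun t i b =>
    potential (c (μt t i)) (Function.update (v t i) i (Psi b)) -
      potential (c μ) (Function.update (f t) i (Psi b))
  have he : ∀ i b, Tendsto (fun t => e t i b) atTop (𝓝 0) := by
    intro i b
    -- Payoff tables and profiles vary together in a compact set, on which the expected payoff is
    -- jointly continuous.
    refine ((isCompact_univ_pi fun a => isCompact_Icc (a := -C a) (b := C a)).prod
      isCompact_profiles).tendsto_sub_of_tendsto_sub (F := F)
      (x := fun t => (c (μt t i), Function.update (v t i) i (Psi b)))
      (y := fun t => (c μ, Function.update (f t) i (Psi b))) hF.continuousOn ?_ ?_ ?_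
    · filter_upwards [eventually_ge_atTop 1] with t ht
      exact ⟨hcC _, update_mem_profiles (h.estimate_mem_profiles hw t ht i) i b⟩
    · filter_upwards [eventually_ge_atTop 1] with t ht
      exact ⟨hcC _, update_mem_profiles (h.freq_mem_profiles t ht) i b⟩
    · have h1 : Tendsto (fun t => c (μt t i) - c μ) atTop (𝓝 0) := by
        rw [tendsto_pi_nhds]
        intro a
        change Tendsto (fun t => c (μt t i) a - c μ a) atTop (𝓝 0)
        rw [← sub_self (c μ a)]
        exact (tendsto_integral_of_tendsto_tv (hμ i) (hu_meas a) (hC a)).sub_const _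
      have h2 : Tendsto (fun t => Function.update (v t i) i (Psi b) -
          Function.update (f t) i (Psi b)) atTop (𝓝 0) := by
        rw [tendsto_pi_nhds]
        intro j
        by_cases hj : j = i
        · subst hj
          simp
        · simpa [hj] using hv i j
      simpa [Prod.mk_zero_zero] using h1.prodMk_nhds h2
  -- Two discrepancies enter: one for the competing action b, one for the action played.
  refine ⟨fun t => 2 * ∑ i, ∑ b, |e t i b|, ?_, ?_⟩
  · have : Tendsto (fun t => 2 * ∑ i, ∑ b, |e t i b|) atTop (𝓝 (2 * ∑ i, ∑ b : A i, |(0 : ℝ)|)) :=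
      (tendsto_finsetSum _ fun i _ => tendsto_finsetSum _ fun b _ => (he i b).abs).const_mul 2
    simpa using this
  · filter_upwards [eventually_ge_atTop 2] with t ht i
    have hle : ∀ b, |e t i b| ≤ ∑ i, ∑ b, |e t i b| := fun b =>
      (Finset.single_le_sum (f := fun b => |e t i b|) (fun _ _ => abs_nonneg _)
        (Finset.mem_univ b)).trans
      (Finset.single_le_sum (f := fun i => ∑ b, |e t i b|)
        (fun _ _ => Finset.sum_nonneg fun _ _ => abs_nonneg _) (Finset.mem_univ i))
    refine bestValue_le _ _ _ fun b => ?_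
    have h1 := h.best_response t ht i b
    rw [expPayoff_eq_potential (hint _), expPayoff_eq_potential (hint _)] at h1
    have h2 := (neg_abs_le (e t i b)).trans' (neg_le_neg (hle b))
    have h3 := (le_abs_self (e t i (a t i))).trans (hle _)
    simp only [e, c] at h2 h3 ⊢
    linarith

end IsRun

end DFP

/-- Convergence of decentralized fictitious play to the set of Nash equilibria of `Γ(μ)`. -/
theorem theorem1 {ι : Type*} [Fintype ι] [DecidableEq ι]
    {A : ι → Type*} [∀ i, Fintype (A i)] [∀ i, DecidableEq (A i)]
    {Θ : Type*} [MeasurableSpace Θ]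
    (u : (∀ i, A i) → Θ → ℝ) (hu_meas : ∀ a, Measurable (u a))
    (hu_bdd : ∀ a, ∃ C : ℝ, ∀ θ, |u a θ| ≤ C)
    (G : ℕ → SimpleGraph ι)
    (h_conn : (DFP.limitGraph G).Connected)
    (h_bdd : DFP.BoundedIntercommunication G)
    (w : ℕ → ι → ι → ι → ℝ) (η : ℝ) (h_w : DFP.WeightAssumption G w η)
    (μt : ℕ → ι → ProbabilityMeasure Θ) (μ : ProbabilityMeasure Θ)
    (h_state : ∀ i, Tendsto (fun t => DFP.tv (μt t i) μ) atTop (𝓝 0))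
    (d : ℕ) (hd : d = 0 ∨ d = 1)
    (a : ℕ → ∀ i, A i) (f : ℕ → ∀ i, A i → ℝ) (v : ℕ → ι → ∀ j, A j → ℝ)
    (h_run : DFP.IsRun u w μt d a f v) :
    ∃ δ : ℕ → ℝ,
      (∀ t, 1 ≤ t → IsLeast ((fun σ => DFP.profileDist (f t) σ) '' DFP.nashSet u μ) (δ t)) ∧
      Tendsto δ atTop (𝓝 0) := by
  -- The initial profile of the run supplies an action for every player.
  have : ∀ i, Nonempty (A i) := fun i => ⟨a 0 i⟩
  have hint : ∀ b, Integrable (u b) (μ : Measure Θ) := fun b => by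
    obtain ⟨C, hC⟩ := hu_bdd b
    exact .of_bound (hu_meas b).aestronglyMeasurable C (.of_forall fun θ => by simpa using hC θ)
  obtain ⟨e, he, hbr⟩ := h_run.exists_asymptotic_best_response hu_meas hu_bdd h_w
    (h_run.tendsto_estimate_sub_freq hd h_w h_conn h_bdd) h_state
  have hgap := DFP.tendsto_gap_of_asymptotic_best_response _ h_run.freq_mem_profiles
    (fun t => DFP.mem_profiles.2 fun i => DFP.Psi_mem_stdSimplex (a t i))
    (fun t ht => funext fun i => h_run.freq_update t ht i) h_run.dist_freq_le he hbr
  obtain ⟨δ, hδ, hlim⟩ :=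
    DFP.tendsto_dist_equilibria_of_tendsto_gap _ h_run.freq_mem_profiles hgap
  rw [DFP.nashSet_eq_equilibria hint]
  exact ⟨δ, fun t _ => hδ t, hlim⟩
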